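/- All graphs are finite and simple, and all groups are finite. The prime graph $\Gamma_G$ of a group $G$ has as vertices the primes dividing $|G|$, two distinct primes $p,q$ being adjacent if and only if $G$ has an element of order $pq$; $\overline{\Gamma}_G$ denotes its complement. A group $H$ is a Frobenius group with kernel $N$ and complement $K$ if $H=N\rtimes K$ with $N,K\neq 1$ and no nonidentity element of $K$ centralizes a nonidentity element of $N$. A group $H$ is $2$-Frobenius of type $(p,q,p)$ if, with $F_1=\mathrm{Fit}(H)$ and $F_2/F_1=\mathrm{Fit}(H/F_1)$, both $F_2$ and $H/F_1$ are Frobenius groups, $F_1$ and $H/F_2$ are $p$-groups, and $F_2/F_1$ is a $q$-group. For a solvable group $G$, the Frobenius digraph $\vec{\Gamma}_G$ is the orientation of $\overline{\Gamma}_G$ in which an edge $pq$ of $\overline{\Gamma}_G$ is directed $p\rightarrow q$ if a Hall $\{p,q\}$-subgroup of $G$ is either a Frobenius group whose complement is a Sylow $p$-subgroup and whose kernel is a Sylow $q$-subgroup, or a $2$-Frobenius group of type $(p,q,p)$. Theorem. Let $F$ be a $3$-colorable triangle-free graph. Then: 1. there is a solvable group $G$ such that $F$ is isomorphic to $\overline{\Gamma}_G$;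 2. $F$ has an acyclic orientation that contains no directed $3$-path (a directed path with three arcs on four distinct vertices); 3. for every acyclic orientation $\vec{F}$ of $F$ that contains no directed $3$-path there is a solvable group $G$ such that $\vec{F}$ is isomorphic to the Frobenius digraph $\vec{\Gamma}_G$ (in particular $F\cong\overline{\Gamma}_G$). -/

import Mathlib

/-! ### Directed graphs -/

/-- The digraph `D` is an orientation of the simple graph `F`: every edge of `F` is
directed in exactly one of the two possible ways, and `D` has no other arcs. -/
def Digraph.IsOrientationOf {V : Type*} (D : Digraph V) (F : SimpleGraph V) : Prop :=
  (∀ v w, F.Adj v w ↔ D.Adj v w ∨ D.Adj w v) ∧ ∀ v w, ¬ (D.Adj v w ∧ D.Adj w v)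

/-- A digraph is acyclic if it has no directed cycle, i.e. no vertex can be reached from
itself along a nonempty directed walk. -/
def Digraph.IsDirectedAcyclic {V : Type*} (D : Digraph V) : Prop :=
  ∀ v, ¬ Relation.TransGen D.Adj v v

/-- The digraph `D` contains a directed `n`-path: `n` consecutive arcs on `n + 1` distinct
vertices. -/
def Digraph.HasDirectedPath {V : Type*} (D : Digraph V) (n : ℕ) : Prop :=
  ∃ f : Fin (n + 1) → V, Function.Injective f ∧ ∀ i : Fin n, D.Adj (f i.castSucc) (f i.succ)

/-! ### Frobenius and 2-Frobenius groups -/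

/-- `G` is a Frobenius group with complement `K` and kernel `N`: `G` is the internal semidirect
product of the nontrivial normal subgroup `N` and the nontrivial subgroup `K`, and `K` acts
fixed point freely on `N` by conjugation. -/
structure IsFrobeniusWith {G : Type*} [Group G] (K N : Subgroup G) : Prop where
  normal : N.Normal
  isComplement : Subgroup.IsComplement' N K
  kernel_ne_bot : N ≠ ⊥
  complement_ne_bot : K ≠ ⊥
  fixedPointFree : ∀ k ∈ K, k ≠ 1 → ∀ n ∈ N, k * n * k⁻¹ = n → n = 1

/-- `G` is a Frobenius group. -/
def IsFrobeniusGroup (G : Type*) [Group G] : Prop :=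
  ∃ K N : Subgroup G, IsFrobeniusWith K N

/-- The Fitting subgroup, generated by all nilpotent normal subgroups. (For a finite group it is
the largest nilpotent normal subgroup.) -/
def fittingSubgroup (G : Type*) [Group G] : Subgroup G :=
  sSup {N : Subgroup G | N.Normal ∧ Group.IsNilpotent N}

instance fittingSubgroup_normal (G : Type*) [Group G] : (fittingSubgroup G).Normal :=
  Subgroup.sSup_normal _ fun _ hN => hN.1

/-- The second Fitting subgroup `F₂`, with `F₂ / F₁ = Fit (G / F₁)` where `F₁ = Fit G`. -/
def secondFittingSubgroup (G : Type*) [Group G] : Subgroup G :=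
  (fittingSubgroup (G ⧸ fittingSubgroup G)).comap (QuotientGroup.mk' (fittingSubgroup G))

instance secondFittingSubgroup_normal (G : Type*) [Group G] :
    (secondFittingSubgroup G).Normal :=
  Subgroup.Normal.comap (fittingSubgroup_normal _) _

/-- `G` is a 2-Frobenius group: `F₂` and `G / F₁` are Frobenius groups. -/
def IsTwoFrobeniusGroup (G : Type*) [Group G] : Prop :=
  IsFrobeniusGroup (secondFittingSubgroup G) ∧ IsFrobeniusGroup (G ⧸ fittingSubgroup G)

/-- `G` is a 2-Frobenius group of type `(p, q, p)`: it is 2-Frobenius, `G / F₂` and `F₁` are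
`p`-groups, and `F₂ / F₁ = Fit (G / F₁)` is a `q`-group. -/
structure IsTwoFrobeniusOfType (G : Type*) [Group G] (p q : ℕ) : Prop where
  isTwoFrobenius : IsTwoFrobeniusGroup G
  top : IsPGroup p (G ⧸ secondFittingSubgroup G)
  middle : IsPGroup q (fittingSubgroup (G ⧸ fittingSubgroup G))
  bottom : IsPGroup p (fittingSubgroup G)

/-- `H` is a Hall `π`-subgroup of the finite group `G`: all primes dividing `|H|` lie in `π`, and
no prime dividing the index of `H` lies in `π`. -/
def IsHallSubgroup {G : Type*} [Group G] (π : Set ℕ) (H : Subgroup G) : Prop :=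
  (∀ r : ℕ, r.Prime → r ∣ Nat.card H → r ∈ π) ∧ ∀ r : ℕ, r.Prime → r ∣ H.index → r ∉ π

/-! ### Prime graph and Frobenius digraph of a finite group -/

/-- The prime graph of a finite group `G`: its vertices are the primes dividing `|G|`, and two
distinct primes `p`, `q` are adjacent when `G` has an element of order `p * q`. -/
def primeGraph (G : Type*) [Group G] : SimpleGraph (Nat.card G).primeFactors where
  Adj p q := p ≠ q ∧ ∃ g : G, orderOf g = (p : ℕ) * (q : ℕ)
  symm := ⟨fun p q h => ⟨h.1.symm, by
    obtain ⟨g, hg⟩ := h.2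
    exact ⟨g, hg.trans (Nat.mul_comm _ _)⟩⟩⟩
  loopless := ⟨fun _ h => h.1 rfl⟩

/-- The Frobenius digraph of a finite solvable group `G`: an edge `pq` of the complement of the
prime graph is directed `p → q` when a Hall `{p, q}`-subgroup of `G` is a Frobenius group whose
complement is a Sylow `p`-subgroup and whose kernel is a Sylow `q`-subgroup, or is a
2-Frobenius group of type `(p, q, p)`. (In a solvable group Hall `{p, q}`-subgroups exist and
any two of them are conjugate, so which one is taken does not matter.) -/
def frobeniusDigraph (G : Type*) [Group G] : Digraph (Nat.card G).primeFactors where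
  Adj p q := (primeGraph G)ᶜ.Adj p q ∧
    ∃ H : Subgroup G, IsHallSubgroup {(p : ℕ), (q : ℕ)} H ∧
      ((∃ (P : Sylow p H) (Q : Sylow q H), IsFrobeniusWith (P : Subgroup H) (Q : Subgroup H)) ∨
        IsTwoFrobeniusOfType H p q)

/-!
The construction starts from an acyclic orientation `D` of the triangle-free graph `F` without
directed `3`-path; directing the edges along a `3`-colouring provides one. Such an orientation has
levels `0`, `1`, `2` that increase along the arcs (`Digraph.exists_level`). Distinct primes `π v`
are attached to the vertices so that `π w ≡ 1` modulo `π v` whenever `w` is on a higher level than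
`v` (`exists_primes_of_level`, from the infinitude of primes `≡ 1` modulo a given number).

A solvable group is then built by adding the vertices by increasing level, each new vertex `c`
being a sink among those already present (`IsLevelling.exists_realizes`). If `G` has been built, the
next group is `N ⋊ G` for a finite `G`-module `N` in characteristic `π c`. By
`Realizes.insert_sink` this works as soon as elements of order `π v` act fixed point freely on
`N` when `v → c` is an arc, and some element of order `π v` fixes a nonzero vector otherwise.

* If `c` has level `0` or `1`, its in-neighbours `a` have level `0`, and `G` maps onto the cyclic
  group of order `π a` for each of them. The product of the corresponding characters with values in
  the field with `π c` elements makes this field the required module `N`.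
* If `c` has level `2`, the in-neighbours of `c` are pairwise non-adjacent, since `F` has no
  triangle. Let `L` be the normal subgroup of `G` on which the projections to the groups of order
  `π a` vanish, for all `a` of level `0` that are not in-neighbours of `c`. It has a linear character
  `χ` that is nontrivial on its elements of order `π v` exactly when `v → c`; it is assembled from
  the coordinates at the in-neighbours of `c` (`IsCoordinateSystem`), all of which are homomorphisms
  on `L`. The module `N` is coinduced from `χ`. Elements of order `π v` with `v → c` lie in `L` and
  have no nonzero fixed vectors; for the other vertices averaging over a cyclic group yields one.

Every arc `v → w` satisfies `IsFrobeniusArc`: there are no elements of order `π v * π w`, a Hall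
subgroup for these two primes exists, and a normal subgroup of `G` cuts out its Sylow subgroup for
`π w`. This property passes from `G` to `N ⋊ G`; it makes the Hall subgroup a Frobenius group with
kernel the Sylow subgroup for `π w`, and excludes that the edge gets the reverse direction in the
Frobenius digraph.
-/

/-! ### Elements and subgroups of finite groups -/

theorem Commute.exists_orderOf_eq_mul {G : Type*} [Group G] [Finite G] {a b : G} {p q : ℕ}
    (h : Commute a b) (hpq : Nat.Coprime p q) (hp : p ∣ orderOf a) (hq : q ∣ orderOf b) :
    ∃ g : G, orderOf g = p * q := by
  have h1 := orderOf_pow_orderOf_div (orderOf_pos a).ne' hp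
  have h2 := orderOf_pow_orderOf_div (orderOf_pos b).ne' hq
  refine ⟨a ^ (orderOf a / p) * b ^ (orderOf b / q), ?_⟩
  rw [(h.pow_pow _ _).orderOf_mul_eq_mul_orderOf_of_coprime (by rwa [h1, h2]), h1, h2]

theorem exists_commute_of_orderOf_eq_mul {G : Type*} [Group G] {g : G} {p q : ℕ} (hp : p ≠ 0)
    (hq : q ≠ 0) (h : orderOf g = p * q) :
    ∃ x y : G, orderOf x = p ∧ orderOf y = q ∧ Commute x y := by
  have h0 : orderOf g ≠ 0 := by rw [h]; exact mul_ne_zero hp hq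
  refine ⟨g ^ q, g ^ p, ?_, ?_, (Commute.refl g).pow_pow _ _⟩
  · have := orderOf_pow_orderOf_div h0 (Dvd.intro _ h.symm : p ∣ orderOf g)
    rwa [h, Nat.mul_div_cancel_left _ (Nat.pos_of_ne_zero hp)] at this
  · have := orderOf_pow_orderOf_div h0 (Dvd.intro_left _ h.symm : q ∣ orderOf g)
    rwa [h, Nat.mul_div_cancel _ (Nat.pos_of_ne_zero hq)] at this

theorem MonoidHom.eq_one_of_coprime_orderOf {G H : Type*} [Group G] [Group H] (f : G →* H)
    {g : G} {n : ℕ} (hg : Nat.Coprime (orderOf g) n) (hn : f g ^ n = 1) : f g = 1 := by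
  rw [← orderOf_eq_one_iff]
  exact Nat.eq_one_of_dvd_coprimes hg (orderOf_map_dvd f g) (orderOf_dvd_of_pow_eq_one hn)

theorem MonoidHom.orderOf_map_of_coprime_ker {G H : Type*} [Group G] [Group H] (f : G →* H) {g : G}
    (hg : Nat.Coprime (orderOf g) (Nat.card f.ker)) : orderOf (f g) = orderOf g := by
  refine Nat.dvd_antisymm (orderOf_map_dvd f g) (orderOf_dvd_of_pow_eq_one ?_)
  have hk : g ^ orderOf (f g) ∈ f.ker := by
    rw [MonoidHom.mem_ker, map_pow, pow_orderOf_eq_one]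
  rw [← orderOf_eq_one_iff]
  exact Nat.eq_one_of_dvd_coprimes hg (orderOf_pow_dvd _) (Subgroup.orderOf_dvd_natCard _ hk)

theorem isPGroup_of_forall_prime_dvd {G : Type*} [Group G] [Finite G] {p : ℕ}
    (h : ∀ r : ℕ, r.Prime → r ∣ Nat.card G → r = p) : IsPGroup p G :=
  IsPGroup.of_card (Nat.eq_prime_pow_of_unique_prime_dvd Nat.card_pos.ne' fun {r} => h r)

/-- A `p`-group is nilpotent, so its nontrivial normal subgroups contain central elements; hence
it is not a Frobenius group. -/
theorem IsPGroup.not_isFrobeniusGroup {G : Type*} [Group G] [Finite G] {p : ℕ} [Fact p.Prime]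
    (hG : IsPGroup p G) : ¬ IsFrobeniusGroup G := by
  rintro ⟨K, N, h⟩
  have := h.normal
  have hN : p ∣ Nat.card N := by
    obtain ⟨n, hn, hn1⟩ := N.bot_or_exists_ne_one.resolve_left h.kernel_ne_bot
    exact (hG.dvd_orderOf hn1).trans (Subgroup.orderOf_dvd_natCard _ hn)
  obtain ⟨n, hn, hn1⟩ :=
    (hG.of_equiv ConjAct.toConjAct).exists_fixed_point_of_prime_dvd_card_of_fixed_point N hN
      (a := 1) fun g => by simp
  obtain ⟨k, hk⟩ := Subgroup.ne_bot_iff_exists_ne_one.1 h.complement_ne_bot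
  refine hn1 (Subtype.ext ?_).symm
  refine h.fixedPointFree k.1 k.2 (fun h1 => hk (Subtype.ext h1)) n.1 n.2 ?_
  have := congrArg Subtype.val (hn (ConjAct.toConjAct k.1))
  simpa [ConjAct.Subgroup.val_conj_smul, ConjAct.smul_def] using this

/-! ### Frobenius arcs -/

/-- A global form of the condition that the Hall `{p, q}`-subgroups of `G` are Frobenius groups
with complement a Sylow `p`-subgroup and kernel a Sylow `q`-subgroup. The normal subgroup in the
last field meets every `{p, q}`-subgroup in its Sylow `q`-subgroup, which is therefore normal. -/
structure IsFrobeniusArc (G : Type*) [Group G] (p q : ℕ) : Prop where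
  orderOf_ne : ∀ g : G, orderOf g ≠ p * q
  exists_hall : ∃ H : Subgroup G, IsHallSubgroup {p, q} H
  exists_normal : ∃ T : Subgroup G, T.Normal ∧ ¬ p ∣ Nat.card T ∧ ¬ q ∣ T.index

namespace IsFrobeniusArc

variable {G : Type*} [Group G] [Finite G] {p q : ℕ}

/-- Every `{p, q}`-subgroup of `G` has a normal Sylow `q`-subgroup. -/
theorem exists_normal_sylow [Fact q.Prime] (h : IsFrobeniusArc G p q)
    (H : Subgroup G) (hH : ∀ r : ℕ, r.Prime → r ∣ Nat.card H → r ∈ ({p, q} : Set ℕ)) :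
    ∃ Q : Sylow q H, (Q : Subgroup H).Normal ∧ ¬ p ∣ Nat.card Q ∧ IsPGroup q Q := by
  obtain ⟨T, hT, hpT, hqT⟩ := h.exists_normal
  have hp : ¬ p ∣ Nat.card (T.subgroupOf H) := fun hd =>
    hpT (hd.trans (Subgroup.card_dvd_of_injective
      ((H.subtype.comp (T.subgroupOf H).subtype).codRestrict T fun x => x.2)
      fun x y hxy => Subtype.ext (Subtype.ext (congrArg (fun t : T => (t : G)) hxy))))
  have hW : IsPGroup q (T.subgroupOf H) := isPGroup_of_forall_prime_dvd fun r hr hd =>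
    (hH r hr (hd.trans (Subgroup.card_subgroup_dvd_card _))).resolve_left fun h => hp (h ▸ hd)
  have hi : ¬ q ∣ (T.subgroupOf H).index := fun hd =>
    hqT (hd.trans (Subgroup.relIndex_dvd_index_of_normal T H))
  exact ⟨hW.toSylow hi, Subgroup.normal_subgroupOf, hp, hW⟩

theorem isFrobeniusWith [hp : Fact p.Prime] [hq : Fact q.Prime] (h : IsFrobeniusArc G p q)
    (hpq : p ≠ q) (hpG : p ∣ Nat.card G) (hqG : q ∣ Nat.card G) {H : Subgroup G}
    (hH : IsHallSubgroup {p, q} H) :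
    ∃ (P : Sylow p H) (Q : Sylow q H), IsFrobeniusWith (P : Subgroup H) (Q : Subgroup H) := by
  obtain ⟨Q, hQn, hpQ, hQ⟩ := h.exists_normal_sylow H hH.1
  let P : Sylow p H := default
  have hcop : Nat.Coprime p q := (Nat.coprime_primes hp.out hq.out).2 hpq
  have hpH : p ∣ Nat.card H := by
    rw [← H.card_mul_index] at hpG
    exact (hp.out.dvd_mul.1 hpG).resolve_right fun hd => hH.2 p hp.out hd (by simp)
  have hqH : q ∣ Nat.card H := by
    rw [← H.card_mul_index] at hqG
    exact (hq.out.dvd_mul.1 hqG).resolve_right fun hd => hH.2 q hq.out hd (by simp)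
  refine ⟨P, Q, hQn, ?_, Q.ne_bot_of_dvd_card hqH, P.ne_bot_of_dvd_card hpH, ?_⟩
  · obtain ⟨k, hk⟩ : ∃ k, (Q : Subgroup H).index = p ^ k :=
      ⟨_, Nat.eq_prime_pow_of_unique_prime_dvd Subgroup.index_ne_zero_of_finite
        fun {r} hr hd => (hH.1 r hr (hd.trans (Subgroup.index_dvd_card _))).resolve_right
          fun h => Q.not_dvd_index (h ▸ hd)⟩
    have hcard : Nat.card Q * p ^ k = Nat.card H := by rw [← hk]; exact Subgroup.card_mul_index _
    have hP : Nat.card P = p ^ k := by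
      rw [P.card_eq_multiplicity, ← hcard, Nat.factorization_mul Nat.card_pos.ne'
        (pow_pos hp.out.pos k).ne', Finsupp.add_apply, Nat.factorization_eq_zero_of_not_dvd hpQ,
        Nat.Prime.factorization_pow hp.out, Finsupp.single_eq_same, zero_add]
    refine Subgroup.isComplement'_of_coprime (by rw [← hcard, ← hP]) ?_
    rw [hP]
    exact ((hp.out.coprime_iff_not_dvd.2 hpQ).pow_left k).symm
  · intro k hk hk1 n hn hkn
    by_contra hn1
    have hc : Commute k n := by
      rw [mul_inv_eq_iff_eq_mul] at hkn
      exact hkn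
    have h1 : p ∣ orderOf k := by
      rw [← Subgroup.orderOf_mk k hk]
      exact P.isPGroup'.dvd_orderOf fun h => hk1 (congrArg Subtype.val h)
    have h2 : q ∣ orderOf n := by
      rw [← Subgroup.orderOf_mk n hn]
      exact hQ.dvd_orderOf fun h => hn1 (congrArg Subtype.val h)
    obtain ⟨g, hg⟩ := hc.exists_orderOf_eq_mul hcop h1 h2
    exact h.orderOf_ne g.1 (by rw [Subgroup.orderOf_coe, hg])

/-- The Sylow `q`-subgroup of a Hall `{p, q}`-subgroup is normal, so it cannot be a Frobenius
complement. -/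
theorem not_isFrobeniusWith [Fact q.Prime] (h : IsFrobeniusArc G p q)
    {H : Subgroup G} (hH : IsHallSubgroup {q, p} H)
    (Q : Sylow q H) (P : Sylow p H) : ¬ IsFrobeniusWith (Q : Subgroup H) (P : Subgroup H) := by
  intro hF
  obtain ⟨Q', hQn, -, -⟩ := h.exists_normal_sylow H (by rw [Set.pair_comm]; exact hH.1)
  have := Sylow.unique_of_normal Q' hQn
  obtain rfl : Q' = Q := Subsingleton.elim _ _
  obtain ⟨k, hk⟩ := Subgroup.ne_bot_iff_exists_ne_one.1 hF.complement_ne_bot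
  obtain ⟨n, hn⟩ := Subgroup.ne_bot_iff_exists_ne_one.1 hF.kernel_ne_bot
  have hc := Subgroup.commute_of_normal_of_disjoint _ _ hQn hF.normal hF.isComplement.disjoint.symm
    k.1 n.1 k.2 n.2
  exact hn (Subtype.ext (hF.fixedPointFree k.1 k.2 (fun h => hk (Subtype.ext h)) n.1 n.2
    (by rw [mul_inv_eq_iff_eq_mul]; exact hc)))

/-- In a group with a normal Sylow `q`-subgroup, this subgroup lies in the Fitting subgroup `F₁`.
If the group were `2`-Frobenius of type `(q, p, q)` then `F₂` would be everything, and the quotient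
by `F₁` would be a `p`-group and a Frobenius group. -/
theorem not_isTwoFrobeniusOfType [Fact p.Prime] [Fact q.Prime]
    (h : IsFrobeniusArc G p q) {H : Subgroup G} (hH : IsHallSubgroup {q, p} H) :
    ¬ IsTwoFrobeniusOfType H q p := by
  intro hF
  obtain ⟨Q, hQn, -, hQ⟩ := h.exists_normal_sylow H (by rw [Set.pair_comm]; exact hH.1)
  have hQ1 : (Q : Subgroup H) ≤ fittingSubgroup H := le_sSup ⟨hQn, hQ.isNilpotent⟩
  have hQ2 : (Q : Subgroup H) ≤ secondFittingSubgroup H := fun x hx => by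
    have h1 : (QuotientGroup.mk' (fittingSubgroup H)) x = 1 :=
      (QuotientGroup.eq_one_iff x).2 (hQ1 hx)
    rw [secondFittingSubgroup, Subgroup.mem_comap, h1]
    exact one_mem _
  have htop : secondFittingSubgroup H = ⊤ := by
    rw [← Subgroup.index_eq_one]
    obtain ⟨k, hk⟩ := IsPGroup.iff_card.1 hF.top
    rcases k with _ | k
    · rwa [pow_zero] at hk
    · refine absurd ?_ Q.not_dvd_index
      refine Dvd.dvd.trans ?_ (Subgroup.index_dvd_of_le hQ2)
      rw [Subgroup.index, hk, pow_succ]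
      exact Dvd.intro_left _ rfl
  have htop' : fittingSubgroup (H ⧸ fittingSubgroup H) = ⊤ := by
    rw [eq_top_iff]
    intro x _
    obtain ⟨y, rfl⟩ := QuotientGroup.mk'_surjective _ x
    have : y ∈ secondFittingSubgroup H := htop ▸ Subgroup.mem_top y
    exact this
  have hP : IsPGroup p (H ⧸ fittingSubgroup H) :=
    (htop' ▸ hF.middle).of_equiv Subgroup.topEquiv
  exact hP.not_isFrobeniusGroup hF.isTwoFrobenius.2

end IsFrobeniusArc

/-! ### Adding a sink by a semidirect product -/

theorem SemidirectProduct.card_ker_rightHom {N G : Type*} [Group N] [Group G]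
    (φ : G →* MulAut N) : Nat.card (rightHom : N ⋊[φ] G →* G).ker = Nat.card N := by
  rw [← range_inl_eq_ker_rightHom]
  exact (Nat.card_congr (MonoidHom.ofInjective inl_injective).toEquiv).symm

theorem SemidirectProduct.card_comap_rightHom {N G : Type*} [Group N] [Group G]
    (φ : G →* MulAut N) (H : Subgroup G) :
    Nat.card (H.comap (rightHom : N ⋊[φ] G →* G)) = Nat.card N * Nat.card H := by
  rw [← Nat.card_prod]
  exact Nat.card_congr
    { toFun := fun x => (x.1.left, ⟨x.1.right, x.2⟩)
      invFun := fun y => ⟨⟨y.1, y.2.1⟩, y.2.2⟩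
      left_inv := fun _ => rfl
      right_inv := fun _ => rfl }

instance SemidirectProduct.finite {N G : Type*} [Group N] [Group G] [Finite N] [Finite G]
    (φ : G →* MulAut N) : Finite (N ⋊[φ] G) := Finite.of_equiv _ equivProd.symm

theorem SemidirectProduct.isSolvable {N G : Type*} [CommGroup N] [Group G] [Group.IsSolvable G]
    (φ : G →* MulAut N) : Group.IsSolvable (N ⋊[φ] G) :=
  Group.isSolvable_of_ker_le_range (inl : N →* N ⋊[φ] G) rightHom range_inl_eq_ker_rightHom.ge

theorem IsFrobeniusArc.semidirectProduct {N G : Type*} [Group N] [Group G] [Finite N] [Finite G]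
    {p q : ℕ} (hp : p.Prime) (hq : q.Prime) (h : IsFrobeniusArc G p q) (φ : G →* MulAut N)
    (hpN : ¬ p ∣ Nat.card N) (hqN : ¬ q ∣ Nat.card N) : IsFrobeniusArc (N ⋊[φ] G) p q := by
  have hpc := hp.coprime_iff_not_dvd.2 hpN
  have hqc := hq.coprime_iff_not_dvd.2 hqN
  refine ⟨fun g hg => h.orderOf_ne (SemidirectProduct.rightHom g) ?_, ?_, ?_⟩
  · rw [MonoidHom.orderOf_map_of_coprime_ker, hg]
    rw [SemidirectProduct.card_ker_rightHom, hg]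
    exact hpc.mul_left hqc
  · obtain ⟨H, h1, h2⟩ := h.exists_hall
    have hcard : Nat.card (H.map (SemidirectProduct.inr : G →* N ⋊[φ] G)) = Nat.card H :=
      (Nat.card_congr (H.equivMapOfInjective _ SemidirectProduct.inr_injective).toEquiv).symm
    have hindex : (H.map (SemidirectProduct.inr : G →* N ⋊[φ] G)).index =
        Nat.card N * H.index := by
      have := (H.map (SemidirectProduct.inr : G →* N ⋊[φ] G)).card_mul_index
      rw [hcard, SemidirectProduct.card, ← H.card_mul_index, mul_left_comm] at this
      exact Nat.eq_of_mul_eq_mul_left Nat.card_pos this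
    refine ⟨H.map SemidirectProduct.inr, fun r hr hd => h1 r hr (hcard ▸ hd), fun r hr hd hm => ?_⟩
    rw [hindex] at hd
    rcases hr.dvd_mul.1 hd with hd | hd
    · rcases hm with rfl | rfl
      exacts [hpN hd, hqN hd]
    · exact h2 r hr hd hm
  · obtain ⟨T, hT, h1, h2⟩ := h.exists_normal
    refine ⟨T.comap SemidirectProduct.rightHom, hT.comap _, ?_, ?_⟩
    · rw [SemidirectProduct.card_comap_rightHom, hp.dvd_mul]
      tauto
    · rwa [T.index_comap_of_surjective SemidirectProduct.rightHom_surjective]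

/-- If the elements of order `p` of `G` act fixed point freely on the abelian `q`-group `N`, then
`p → q` becomes a Frobenius arc of `N ⋊ G`. -/
theorem IsFrobeniusArc.of_fixedPointFree {N G : Type*} [CommGroup N] [Group G] [Finite N]
    [Finite G] {p q : ℕ} (hp : p.Prime) (hq : q.Prime) (hpq : p ≠ q) (φ : G →* MulAut N)
    (hN : IsPGroup q N) (hqG : ¬ q ∣ Nat.card G)
    (hfpf : ∀ x : G, orderOf x = p → ∀ n : N, φ x n = n → n = 1) :
    IsFrobeniusArc (N ⋊[φ] G) p q := by
  have := Fact.mk hp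
  have := Fact.mk hq
  obtain ⟨k, hk⟩ := IsPGroup.iff_card.1 hN
  have hpN : ¬ p ∣ Nat.card N := fun hd =>
    hpq ((Nat.prime_dvd_prime_iff_eq hp hq).1 (hp.dvd_of_dvd_pow (hk ▸ hd)))
  have hcardker := SemidirectProduct.card_ker_rightHom φ
  refine ⟨fun g hg => ?_, ?_, ?_⟩
  · obtain ⟨x, y, hx, hy, hxy⟩ := exists_commute_of_orderOf_eq_mul hp.ne_zero hq.ne_zero hg
    have hx' : orderOf x.right = p := by
      rw [← hx]
      refine MonoidHom.orderOf_map_of_coprime_ker SemidirectProduct.rightHom ?_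
      rw [hcardker, hx]
      exact hp.coprime_iff_not_dvd.2 hpN
    have hy' : y.right = 1 := by
      refine MonoidHom.eq_one_of_coprime_orderOf SemidirectProduct.rightHom (n := Nat.card G) ?_
        pow_card_eq_one'
      rw [hy]
      exact hq.coprime_iff_not_dvd.2 hqG
    have hl := congrArg SemidirectProduct.left hxy.eq
    rw [SemidirectProduct.mul_left, SemidirectProduct.mul_left, hy', map_one, MulAut.one_apply,
      mul_comm, mul_left_inj] at hl
    have hy1 : y = 1 := SemidirectProduct.ext (hfpf _ hx' _ hl) hy'
    rw [hy1, orderOf_one] at hy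
    exact hq.one_lt.ne hy
  · obtain ⟨P⟩ : Nonempty (Sylow p G) := inferInstance
    refine ⟨(P : Subgroup G).comap SemidirectProduct.rightHom, fun r hr hd => ?_,
      fun r hr hd hm => ?_⟩
    · rw [SemidirectProduct.card_comap_rightHom, hk, P.card_eq_multiplicity] at hd
      rcases hr.dvd_mul.1 hd with hd | hd
      · exact Or.inr ((Nat.prime_dvd_prime_iff_eq hr hq).1 (hr.dvd_of_dvd_pow hd))
      · exact Or.inl ((Nat.prime_dvd_prime_iff_eq hr hp).1 (hr.dvd_of_dvd_pow hd))
    · rw [Subgroup.index_comap_of_surjective _ SemidirectProduct.rightHom_surjective] at hd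
      rcases hm with rfl | rfl
      · exact P.not_dvd_index hd
      · exact hqG (hd.trans (Subgroup.index_dvd_card _))
  · refine ⟨SemidirectProduct.rightHom.ker, inferInstance, by rwa [hcardker], ?_⟩
    rw [Subgroup.index_ker, MonoidHom.range_eq_top.2 SemidirectProduct.rightHom_surjective,
      Subgroup.card_top]
    exact hqG

/-- The group `G` realizes the digraph induced by `D` on the set `s` of vertices, the vertex `v`
being represented by the prime `π v`. -/
structure Realizes {V : Type*} (D : Digraph V) (π : V → ℕ) (s : Set V) (G : Type*) [Group G] :
    Prop where
  dvd_card_iff : ∀ r : ℕ, r.Prime → (r ∣ Nat.card G ↔ ∃ v ∈ s, π v = r)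
  exists_orderOf : ∀ v ∈ s, ∀ w ∈ s, v ≠ w → ¬ D.Adj v w → ¬ D.Adj w v →
    ∃ g : G, orderOf g = π v * π w
  isFrobeniusArc : ∀ v ∈ s, ∀ w ∈ s, D.Adj v w → IsFrobeniusArc G (π v) (π w)

/-- Adding a sink `c` to a realization `G`, by means of a `π c`-group `N` on which `G` acts: the
elements of order `π v` have to act fixed point freely exactly for the in-neighbours `v` of `c`. -/
theorem Realizes.insert_sink {V : Type*} {D : Digraph V} {π : V → ℕ} {s : Set V}
    (hπ : ∀ v, (π v).Prime) (hinj : Function.Injective π) {G N : Type*} [Group G] [Finite G]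
    [CommGroup N] [Finite N] [Nontrivial N] (h : Realizes D π s G) {c : V} (hc : c ∉ s)
    (hloop : ¬ D.Adj c c) (hsink : ∀ v ∈ s, ¬ D.Adj c v) (hN : IsPGroup (π c) N)
    (φ : G →* MulAut N)
    (hfpf : ∀ v ∈ s, D.Adj v c → ∀ x : G, orderOf x = π v → ∀ n : N, φ x n = n → n = 1)
    (hfix : ∀ v ∈ s, ¬ D.Adj v c → ∃ x : G, orderOf x = π v ∧ ∃ n : N, n ≠ 1 ∧ φ x n = n) :
    Realizes D π (insert c s) (N ⋊[φ] G) := by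
  have := Fact.mk (hπ c)
  obtain ⟨k, hk⟩ := IsPGroup.iff_card.1 hN
  have hcN : π c ∣ Nat.card N := by
    obtain ⟨n, hn⟩ := exists_ne (1 : N)
    exact (hN.dvd_orderOf hn).trans (orderOf_dvd_natCard n)
  have hdvdN : ∀ r : ℕ, r.Prime → (r ∣ Nat.card N ↔ π c = r) := fun r hr =>
    ⟨fun hd => ((Nat.prime_dvd_prime_iff_eq hr (hπ c)).1 (hr.dvd_of_dvd_pow (hk ▸ hd))).symm,
      fun h => h ▸ hcN⟩
  have hne : ∀ v ∈ s, π v ≠ π c := fun v hv h => hc (hinj h ▸ hv)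
  have hvN : ∀ v ∈ s, ¬ π v ∣ Nat.card N := fun v hv hd =>
    hne v hv ((hdvdN _ (hπ v)).1 hd).symm
  have hcG : ¬ π c ∣ Nat.card G := fun hd => by
    obtain ⟨v, hv, hvc⟩ := (h.dvd_card_iff _ (hπ c)).1 hd
    exact hne v hv hvc
  have hnew : ∀ v ∈ s, ¬ D.Adj v c → ∃ g : N ⋊[φ] G, orderOf g = π v * π c := by
    intro v hv hvc
    obtain ⟨x, hx, n, hn1, hn⟩ := hfix v hv hvc
    have hcomm : Commute (SemidirectProduct.inr x : N ⋊[φ] G) (SemidirectProduct.inl n) := by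
      have := SemidirectProduct.inl_aut (φ := φ) x n
      rw [hn, map_inv, eq_mul_inv_iff_mul_eq] at this
      exact this.symm
    refine hcomm.exists_orderOf_eq_mul ((Nat.coprime_primes (hπ v) (hπ c)).2 (hne v hv)) ?_ ?_
    · rw [orderOf_injective _ SemidirectProduct.inr_injective, hx]
    · rw [orderOf_injective _ SemidirectProduct.inl_injective]
      exact hN.dvd_orderOf hn1
  refine ⟨fun r hr => ?_, ?_, ?_⟩
  · rw [SemidirectProduct.card, hr.dvd_mul, hdvdN r hr, h.dvd_card_iff r hr]
    simp
  · rintro v (rfl | hv) w (rfl | hw) hvw h1 h2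
    · exact absurd rfl hvw
    · rw [mul_comm]
      exact hnew w hw h2
    · exact hnew v hv h1
    · obtain ⟨g, hg⟩ := h.exists_orderOf v hv w hw hvw h1 h2
      exact ⟨SemidirectProduct.inr g, by
        rw [orderOf_injective _ SemidirectProduct.inr_injective, hg]⟩
  · rintro v (rfl | hv) w (rfl | hw) hvw
    · exact absurd hvw hloop
    · exact absurd hvw (hsink w hw)
    · exact IsFrobeniusArc.of_fixedPointFree (hπ v) (hπ _) (hne v hv) φ hN hcG (hfpf v hv hvw)
    · exact (h.isFrobeniusArc v hv w hw hvw).semidirectProduct (hπ v) (hπ w) φ (hvN v hv)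
        (hvN w hw)

/-! ### Characters and coinduced modules -/

theorem exists_injective_zmod_units {p r : ℕ} [Fact p.Prime] [Fact r.Prime] (h : p ∣ r - 1) :
    ∃ χ : Multiplicative (ZMod p) →* (ZMod r)ˣ, Function.Injective χ := by
  obtain ⟨u, hu⟩ := exists_prime_orderOf_dvd_card' (G := (ZMod r)ˣ) p
    (by rwa [Nat.card_eq_fintype_card, ZMod.card_units])
  have hcard : Nat.card (Multiplicative (ZMod p)) = Nat.card (Subgroup.zpowers u) := by
    rw [Nat.card_zpowers, hu, Nat.card_congr Multiplicative.toAdd, Nat.card_zmod]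
  exact ⟨(Subgroup.zpowers u).subtype.comp (mulEquivOfCyclicCardEq hcard).toMonoidHom,
    (Subtype.val_injective).comp (mulEquivOfCyclicCardEq hcard).injective⟩

theorem pow_zmod_multiplicative {p : ℕ} (x : Multiplicative (ZMod p)) : x ^ p = 1 := by
  rw [← ofAdd_toAdd x, ← ofAdd_nsmul, nsmul_eq_mul, CharP.cast_eq_zero, zero_mul, ofAdd_zero]

/-- Homomorphisms to groups of distinct prime orders `π i` combine to a single linear character
over the field with `r` elements, provided that `r ≡ 1` modulo each `π i`. -/
theorem exists_character {ι L : Type*} [Finite ι] [Group L] {π : ι → ℕ} (hπ : ∀ i, (π i).Prime)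
    (hinj : Function.Injective π) {r : ℕ} [Fact r.Prime] (hr : ∀ i, π i ∣ r - 1)
    (f : ∀ i, L →* Multiplicative (ZMod (π i))) :
    ∃ χ : L →* (ZMod r)ˣ, (∀ x, (∀ i, f i x = 1) → χ x = 1) ∧
      ∀ i x, orderOf x = π i → χ x = 1 → f i x = 1 := by
  have := Fintype.ofFinite ι
  have hχ : ∀ i, ∃ χ : Multiplicative (ZMod (π i)) →* (ZMod r)ˣ, Function.Injective χ := fun i =>
    have := Fact.mk (hπ i)
    exists_injective_zmod_units (hr i)
  choose χ hχ using hχ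
  refine ⟨∏ i, (χ i).comp (f i), fun x hx => ?_, fun i x hx h1 => ?_⟩
  · rw [MonoidHom.finsetProd_apply]
    exact Finset.prod_eq_one fun i _ => by rw [MonoidHom.comp_apply, hx, map_one]
  · rw [MonoidHom.finsetProd_apply, Finset.prod_eq_single i] at h1
    · exact (injective_iff_map_eq_one _).1 (hχ i) _ h1
    · intro j _ hji
      rw [MonoidHom.comp_apply, (f j).eq_one_of_coprime_orderOf (n := π j) ?_
        (pow_zmod_multiplicative _), map_one]
      rw [hx]
      exact (Nat.coprime_primes (hπ i) (hπ j)).2 fun h => hji (hinj h).symm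
    · exact fun h => absurd (Finset.mem_univ _) h

/-- The action of a group on the additive group of `ZMod r` through a linear character. -/
def MonoidHom.characterAction {G : Type*} [Group G] {r : ℕ} (χ : G →* (ZMod r)ˣ) :
    G →* MulAut (Multiplicative (ZMod r)) :=
  (MulAutMultiplicative (ZMod r)).symm.toMonoidHom.comp
    ((DistribMulAction.toAddAut (ZMod r)ˣ (ZMod r)).comp χ)

theorem MonoidHom.characterAction_apply {G : Type*} [Group G] {r : ℕ} (χ : G →* (ZMod r)ˣ)
    (g : G) (n : Multiplicative (ZMod r)) :
    χ.characterAction g n = Multiplicative.ofAdd ((χ g : ZMod r) * n.toAdd) := rfl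

section Coinduced

variable {G : Type*} [Group G] {L : Subgroup G} {r : ℕ}

/-- The module coinduced from the linear character `χ` of the subgroup `L`, realized as a group of
functions on `G` on which `G` acts by right translation. -/
def coinducedModule (χ : L →* (ZMod r)ˣ) : AddSubgroup (G → ZMod r) where
  carrier := {F | ∀ (l : L) (h : G), F (l * h) = χ l * F h}
  zero_mem' := fun l h => by simp
  add_mem' := fun hF hF' l h => by simp [hF l h, hF' l h, mul_add]
  neg_mem' := fun hF l h => by simp [hF l h]

variable (χ : L →* (ZMod r)ˣ)

instance coinducedModule.distribMulAction : DistribMulAction G (coinducedModule χ) where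
  smul g F := ⟨fun h => F.1 (h * g), fun l h =>
    (congrArg F.1 (mul_assoc _ _ _)).trans (F.2 l (h * g))⟩
  one_smul F := Subtype.ext (funext fun h => congrArg F.1 (mul_one h))
  mul_smul g g' F := Subtype.ext (funext fun h => congrArg F.1 (mul_assoc h g g').symm)
  smul_zero _ := rfl
  smul_add _ _ _ := rfl

/-- The automorphisms of the multiplicative form of the coinduced module given by `G`. -/
def coinducedAction : G →* MulAut (Multiplicative (coinducedModule χ)) :=
  (MulAutMultiplicative (coinducedModule χ)).symm.toMonoidHom.comp
    (DistribMulAction.toAddAut G (coinducedModule χ))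

theorem coinducedAction_eq_self_iff (g : G) (n : Multiplicative (coinducedModule χ)) :
    coinducedAction χ g n = n ↔ ∀ h : G, n.toAdd.1 (h * g) = n.toAdd.1 h := by
  constructor
  · intro H h
    exact congrFun (congrArg (fun m : Multiplicative (coinducedModule χ) => m.toAdd.1) H) h
  · intro H
    exact congrArg Multiplicative.ofAdd (Subtype.ext (funext H))

theorem isPGroup_coinducedModule : IsPGroup r (Multiplicative (coinducedModule χ)) := fun n => by
  refine ⟨1, Multiplicative.toAdd.injective (Subtype.ext (funext fun h => ?_))⟩
  rw [pow_one, toAdd_pow]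
  change r • n.toAdd.1 h = 0
  rw [nsmul_eq_mul, CharP.cast_eq_zero, zero_mul]

theorem coinducedAction_fixedPointFree [Fact r.Prime] [hL : L.Normal] {x : G} (hx : x ∈ L)
    (hχ : ∀ g : G, χ ⟨g * x * g⁻¹, hL.conj_mem x hx g⟩ ≠ 1)
    (n : Multiplicative (coinducedModule χ)) (hn : coinducedAction χ x n = n) : n = 1 := by
  rw [coinducedAction_eq_self_iff] at hn
  refine Multiplicative.toAdd.injective (Subtype.ext (funext fun h => ?_))
  have h1 : n.toAdd.1 h = χ ⟨h * x * h⁻¹, hL.conj_mem x hx h⟩ * n.toAdd.1 h :=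
    ((hn h).symm.trans (congrArg n.toAdd.1 (inv_mul_cancel_right (h * x) h).symm)).trans
      (n.toAdd.2 ⟨h * x * h⁻¹, hL.conj_mem x hx h⟩ h)
  by_contra h0
  exact hχ h (Units.ext (mul_right_cancel₀ h0 (h1.symm.trans (one_mul _).symm)))

/-- If `χ` is trivial on the intersection of `L` with the cyclic group generated by `x`, then
averaging over this cyclic group yields a nonzero vector fixed by `x`. -/
theorem exists_coinducedAction_eq_self [Finite G] [hr : Fact r.Prime] {x : G} (hx : ¬ r ∣ orderOf x)
    (hχ : ∀ l : L, (l : G) ∈ Subgroup.zpowers x → χ l = 1) :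
    ∃ n : Multiplicative (coinducedModule χ), n ≠ 1 ∧ coinducedAction χ x n = n := by
  classical
  have := Fintype.ofFinite (Subgroup.zpowers x)
  let δ : G → ZMod r := fun h => if hh : h ∈ L then χ ⟨h, hh⟩ else 0
  have hδ : ∀ (l : L) (h : G), δ (l * h) = χ l * δ h := fun l h => by
    by_cases hh : h ∈ L
    · have : (l : G) * h ∈ L := mul_mem l.2 hh
      simp only [δ, dif_pos this, dif_pos hh]
      rw [← Units.val_mul, ← map_mul]
      rfl
    · have : (l : G) * h ∉ L := fun h' => hh ((L.mul_mem_cancel_left l.2).1 h')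
      simp only [δ, dif_neg this, dif_neg hh, mul_zero]
  let F : coinducedModule χ := ⟨fun h => ∑ y : Subgroup.zpowers x, δ (h * y), fun l h => by
    rw [Finset.mul_sum]
    exact Finset.sum_congr rfl fun y _ => by rw [mul_assoc, hδ]⟩
  refine ⟨Multiplicative.ofAdd F, fun h0 => ?_, ?_⟩
  · have hF : F.1 1 = 0 := congrFun (congrArg Subtype.val (ofAdd_eq_one.1 h0)) 1
    have hterm : ∀ y : Subgroup.zpowers x, δ (1 * y) = if (y : G) ∈ L then 1 else 0 := fun y => by
      rw [one_mul]
      by_cases hy : (y : G) ∈ L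
      · simp only [δ, dif_pos hy, if_pos hy, hχ ⟨y, hy⟩ y.2, Units.val_one]
      · simp only [δ, dif_neg hy, if_neg hy]
    -- The value at `1` is the order of a subgroup of the cyclic group, hence prime to `r`.
    have hsum : F.1 1 = (Nat.card (L.subgroupOf (Subgroup.zpowers x)) : ZMod r) := by
      have hcard : Nat.card (L.subgroupOf (Subgroup.zpowers x)) =
          (Finset.univ.filter fun y : Subgroup.zpowers x => (y : G) ∈ L).card :=
        Nat.subtype_card _ fun y => by simp [Subgroup.mem_subgroupOf]
      rw [hcard, ← Finset.sum_boole]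
      exact Finset.sum_congr rfl fun y _ => hterm y
    rw [hsum, ZMod.natCast_eq_zero_iff] at hF
    refine hx (hF.trans ?_)
    rw [← Nat.card_zpowers]
    exact Subgroup.card_subgroup_dvd_card _
  · rw [coinducedAction_eq_self_iff]
    intro h
    change ∑ y : Subgroup.zpowers x, δ (h * x * y) = ∑ y : Subgroup.zpowers x, δ (h * y)
    exact Fintype.sum_equiv (Equiv.mulLeft ⟨x, Subgroup.mem_zpowers x⟩) _ _ fun y => by
      rw [mul_assoc]; rfl

end Coinduced

/-! ### Realizing a levelled digraph -/

theorem MonoidHom.ne_one_of_orderOf_eq {L : Type*} [Group L] [Finite L] {p : ℕ} [hp : Fact p.Prime]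
    (f : L →* Multiplicative (ZMod p)) (hf : ∃ g, f g ≠ 1) (hL : ¬ p ^ 2 ∣ Nat.card L) {x : L}
    (hx : orderOf x = p) : f x ≠ 1 := by
  intro h1
  have h2 : p ∣ Nat.card f.ker := hx ▸ Subgroup.orderOf_dvd_natCard f.ker h1
  obtain ⟨g, hg⟩ := hf
  have h3 : p ∣ f.ker.index := by
    have h4 : orderOf (f g) = p := orderOf_eq_prime (pow_zmod_multiplicative _) hg
    rw [Subgroup.index_ker]
    exact h4.symm.dvd.trans (Subgroup.orderOf_dvd_natCard _ ⟨g, rfl⟩)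
  refine hL ?_
  rw [← f.ker.card_mul_index, sq]
  exact mul_dvd_mul h2 h3

/-- The combinatorial data of the construction: levels `0`, `1`, `2` increasing along the arcs of
a digraph without transitive triangles, and distinct primes `π v` attached to the vertices, each
congruent to `1` modulo all the primes attached to lower levels. -/
structure IsLevelling {V : Type*} (D : Digraph V) (ℓ π : V → ℕ) : Prop where
  lt_of_adj : ∀ v w, D.Adj v w → ℓ v < ℓ w
  le_two : ∀ v, ℓ v ≤ 2
  not_adj_of_adj_adj : ∀ a b c, D.Adj a b → D.Adj b c → ¬ D.Adj a c
  prime : ∀ v, (π v).Prime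
  injective : Function.Injective π
  dvd_sub_one : ∀ v w, ℓ v < ℓ w → π v ∣ π w - 1

/-- Coordinates on the group `G`: the function `f v` takes values in `ZMod (π v)`, vanishes
identically for `v ∉ s`, and is additive as soon as the left factor has vanishing coordinates at
all in-neighbours of `v`. -/
structure IsCoordinateSystem {V : Type*} (D : Digraph V) (π : V → ℕ) (s : Set V) (G : Type*)
    [Group G] (f : ∀ v, G → ZMod (π v)) : Prop where
  eq_zero : ∀ v, v ∉ s → ∀ g, f v g = 0
  map_mul : ∀ v g h, (∀ a, D.Adj a v → f a g = 0) → f v (g * h) = f v g + f v h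
  exists_dual : ∀ v ∈ s, ∃ g, f v g ≠ 0 ∧ ∀ w, w ≠ v → f w g = 0
  not_sq_dvd : ∀ v ∈ s, ¬ π v ^ 2 ∣ Nat.card G

theorem not_sq_dvd_mul {p m n : ℕ} (hp : p.Prime) (hm : ¬ p ∣ m) (hn : ¬ p ^ 2 ∣ n) :
    ¬ p ^ 2 ∣ m * n := fun h =>
  hn (((hp.coprime_iff_not_dvd.2 hm).pow_left 2).dvd_of_dvd_mul_left h)

namespace IsLevelling

variable {V : Type*} {D : Digraph V} {ℓ π : V → ℕ}

theorem not_adj_self (hD : IsLevelling D ℓ π) (v : V) : ¬ D.Adj v v := fun h =>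
  (hD.lt_of_adj v v h).ne rfl

theorem coprime (hD : IsLevelling D ℓ π) {v w : V} (h : v ≠ w) : Nat.Coprime (π v) (π w) :=
  (Nat.coprime_primes (hD.prime v) (hD.prime w)).2 fun h' => h (hD.injective h')

theorem not_adj_of_level_eq_zero (hD : IsLevelling D ℓ π) {v : V} (hv : ℓ v = 0) (a : V) :
    ¬ D.Adj a v := fun h => by
  have := hD.lt_of_adj a v h
  omega

/-- A vertex of level at most `1` is added by letting the group act on `ZMod (π c)` through a
linear character that involves exactly the coordinates at the in-neighbours of `c`. -/
theorem exists_insert_low [Finite V] (hD : IsLevelling D ℓ π) {s : Set V} {c : V} (hc : c ∉ s)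
    (hmax : ∀ v ∈ s, ℓ v ≤ ℓ c) (hlow : ℓ c ≤ 1) {G : Type} [Group G] [Finite G]
    [Group.IsSolvable G] (hG : Realizes D π s G) {f : ∀ v, G → ZMod (π v)}
    (hf : IsCoordinateSystem D π {v ∈ s | ℓ v ≤ 1} G f) :
    ∃ (G' : Type) (_ : Group G') (f' : ∀ v, G' → ZMod (π v)), Finite G' ∧ Group.IsSolvable G' ∧
      Realizes D π (insert c s) G' ∧ IsCoordinateSystem D π {v ∈ insert c s | ℓ v ≤ 1} G' f' := by
  classical
  have hp := hD.prime
  have := Fact.mk (hp c)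
  have hsink : ∀ v ∈ s, ¬ D.Adj c v := fun v hv h => by
    have := hD.lt_of_adj c v h
    have := hmax v hv
    omega
  have hcG : ¬ π c ∣ Nat.card G := fun hd => by
    obtain ⟨v, hv, hvc⟩ := (hG.dvd_card_iff _ (hp c)).1 hd
    exact hc (hD.injective hvc ▸ hv)
  have hnbr : ∀ u, D.Adj u c → ℓ u = 0 := fun u hu => by
    have := hD.lt_of_adj u c hu
    omega
  let F : ∀ u : {u // D.Adj u c}, G →* Multiplicative (ZMod (π u)) := fun u =>
    MonoidHom.mk' (fun g => Multiplicative.ofAdd (f u g)) fun g h =>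
      congrArg Multiplicative.ofAdd (hf.map_mul u g h fun a ha =>
        absurd ha (hD.not_adj_of_level_eq_zero (hnbr u u.2) a))
  obtain ⟨χ, hχ1, hχ2⟩ := exists_character (fun u : {u // D.Adj u c} => hp u)
    (fun u v h => Subtype.ext (hD.injective h)) (r := π c)
    (fun u => hD.dvd_sub_one u c (hD.lt_of_adj u c u.2)) F
  have : Nontrivial (Multiplicative (ZMod (π c))) := inferInstanceAs (Nontrivial (ZMod (π c)))
  have : Finite (Multiplicative (ZMod (π c))) := inferInstanceAs (Finite (ZMod (π c)))
  have hcard : Nat.card (Multiplicative (ZMod (π c))) = π c := by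
    rw [Nat.card_congr Multiplicative.toAdd, Nat.card_zmod]
  refine ⟨Multiplicative (ZMod (π c)) ⋊[χ.characterAction] G, inferInstance,
    Function.update (fun v g => f v g.right) c fun g => g.left.toAdd, inferInstance,
    SemidirectProduct.isSolvable _, ?_, ?_⟩
  · refine hG.insert_sink hp hD.injective hc (hD.not_adj_self c) hsink
      (IsPGroup.of_card (n := 1) (by rw [hcard, pow_one])) _ ?_ ?_
    · intro v hv hvc x hx n hn
      have := Fact.mk (hp v)
      have hvs : v ∈ {v ∈ s | ℓ v ≤ 1} := ⟨hv, (hnbr v hvc).le.trans zero_le_one⟩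
      obtain ⟨g, hg, -⟩ := hf.exists_dual v hvs
      have hne : F ⟨v, hvc⟩ x ≠ 1 := (F ⟨v, hvc⟩).ne_one_of_orderOf_eq
        ⟨g, fun h => hg (ofAdd_eq_one.1 h)⟩ (hf.not_sq_dvd v hvs) hx
      rw [MonoidHom.characterAction_apply] at hn
      have hn' : (χ x : ZMod (π c)) * n.toAdd = n.toAdd := congrArg Multiplicative.toAdd hn
      by_contra hn1
      refine hne (hχ2 ⟨v, hvc⟩ x hx (Units.ext (mul_right_cancel₀ (b := n.toAdd) ?_ ?_)))
      · exact fun h => hn1 (toAdd_eq_zero.1 h)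
      · rw [hn', Units.val_one, one_mul]
    · intro v hv hvc
      have := Fact.mk (hp v)
      obtain ⟨x, hx⟩ := exists_prime_orderOf_dvd_card' (G := G) (π v)
        ((hG.dvd_card_iff _ (hp v)).2 ⟨v, hv, rfl⟩)
      obtain ⟨n, hn⟩ := exists_ne (1 : Multiplicative (ZMod (π c)))
      refine ⟨x, hx, n, hn, ?_⟩
      have hχx : χ x = 1 := hχ1 x fun u => (F u).eq_one_of_coprime_orderOf (n := π u)
        (by rw [hx]; exact hD.coprime fun h => hvc (h ▸ u.2)) (pow_zmod_multiplicative _)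
      rw [MonoidHom.characterAction_apply, hχx, Units.val_one, one_mul, ofAdd_toAdd]
  · have hupd : ∀ v, v ≠ c → ∀ g, Function.update (β := fun v =>
        (Multiplicative (ZMod (π c)) ⋊[χ.characterAction] G) → ZMod (π v))
        (fun v g => f v g.right) c (fun g => g.left.toAdd) v g = f v g.right := fun v hv g => by
      rw [Function.update_of_ne hv]
    have hone : ∀ v, f v 1 = 0 := by
      have h0 : ∀ v, ℓ v = 0 → f v 1 = 0 := fun v hv => by
        have := hf.map_mul v 1 1 fun a ha => absurd ha (hD.not_adj_of_level_eq_zero hv a)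
        rwa [mul_one, left_eq_add] at this
      intro v
      by_cases hv : v ∈ {v ∈ s | ℓ v ≤ 1}
      · have := hf.map_mul v 1 1 fun a ha => h0 a (by
          have := hD.lt_of_adj a v ha
          have := hv.2
          omega)
        rwa [mul_one, left_eq_add] at this
      · exact hf.eq_zero v hv 1
    refine ⟨fun v hv g => ?_, fun v g h hg => ?_, ?_, ?_⟩
    · have hvc : v ≠ c := fun h => hv ⟨Or.inl h, h ▸ hlow⟩
      rw [hupd v hvc]
      exact hf.eq_zero v (fun h => hv ⟨Or.inr h.1, h.2⟩) _
    · by_cases hvc : v = c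
      · subst hvc
        have hχg : χ g.right = 1 := hχ1 _ fun u => by
          have := hg u u.2
          rw [hupd u fun h => hD.not_adj_self _ (h ▸ u.2)] at this
          exact ofAdd_eq_one.2 this
        simp only [Function.update_self]
        rw [SemidirectProduct.mul_left, MonoidHom.characterAction_apply, hχg, Units.val_one,
          one_mul, ofAdd_toAdd, toAdd_mul]
      · rw [hupd v hvc, hupd v hvc, hupd v hvc]
        by_cases hv : v ∈ {v ∈ s | ℓ v ≤ 1}
        · refine hf.map_mul v _ _ fun a ha => ?_
          have := hg a ha
          rwa [hupd a fun h => hsink v hv.1 (h ▸ ha)] at this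
        · simp only [hf.eq_zero v hv, add_zero]
    · rintro v ⟨rfl | hv, hvl⟩
      · refine ⟨SemidirectProduct.inl (Multiplicative.ofAdd 1), ?_, fun w hw => ?_⟩
        · simp only [Function.update_self]
          exact one_ne_zero
        · rw [hupd w hw, SemidirectProduct.right_inl, hone]
      · obtain ⟨g, hg, hg'⟩ := hf.exists_dual v ⟨hv, hvl⟩
        refine ⟨SemidirectProduct.inr g, ?_, fun w hw => ?_⟩
        · rwa [hupd v fun h => hc (h ▸ hv)]
        · by_cases hwc : w = c
          · subst hwc
            simp only [Function.update_self]
            rfl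
          · rw [hupd w hwc]
            exact hg' w hw
    · rintro v ⟨rfl | hv, hvl⟩
      · rw [SemidirectProduct.card, hcard, sq]
        exact fun h => hcG (Nat.dvd_of_mul_dvd_mul_left (hp _).pos h)
      · rw [SemidirectProduct.card, hcard]
        refine not_sq_dvd_mul (hp v) (fun h => ?_) (hf.not_sq_dvd v ⟨hv, hvl⟩)
        exact hc (hD.injective ((Nat.prime_dvd_prime_iff_eq (hp v) (hp c)).1 h) ▸ hv)

/-- A vertex `c` of level `2` is added by means of a coinduced module. The in-neighbours of `c` are
pairwise non-adjacent, so their coordinates are homomorphisms on the subgroup `L` on which the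
coordinates at the other vertices of level `0` vanish. The character of `L` built from them is
coinduced to the whole group. -/
theorem exists_insert_high [Finite V] (hD : IsLevelling D ℓ π) {s : Set V} {c : V} (hc : c ∉ s)
    (hhigh : ℓ c = 2) {G : Type} [Group G] [Finite G]
    [Group.IsSolvable G] (hG : Realizes D π s G) {f : ∀ v, G → ZMod (π v)}
    (hf : IsCoordinateSystem D π {v ∈ s | ℓ v ≤ 1} G f) :
    ∃ (G' : Type) (_ : Group G') (f' : ∀ v, G' → ZMod (π v)), Finite G' ∧ Group.IsSolvable G' ∧
      Realizes D π (insert c s) G' ∧ IsCoordinateSystem D π {v ∈ insert c s | ℓ v ≤ 1} G' f' := by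
  have hp := hD.prime
  have := Fact.mk (hp c)
  have hnbr : ∀ u, D.Adj u c → ℓ u ≤ 1 := fun u hu => by
    have := hD.lt_of_adj u c hu
    omega
  have hsink : ∀ v ∈ s, ¬ D.Adj c v := fun v _ h => by
    have := hD.lt_of_adj c v h
    have := hD.le_two v
    omega
  let E : ∀ a : {a // ℓ a = 0 ∧ ¬ D.Adj a c}, G →* Multiplicative (ZMod (π a)) := fun a =>
    MonoidHom.mk' (fun g => Multiplicative.ofAdd (f a g)) fun g h =>
      congrArg Multiplicative.ofAdd (hf.map_mul a g h fun b hb =>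
        absurd hb (hD.not_adj_of_level_eq_zero a.2.1 b))
  let L : Subgroup G := ⨅ a, (E a).ker
  have hL : L.Normal := Subgroup.normal_iInf_normal fun a => inferInstance
  have hmem : ∀ g, g ∈ L ↔ ∀ a, ℓ a = 0 → ¬ D.Adj a c → f a g = 0 := fun g => by
    rw [Subgroup.mem_iInf]
    exact ⟨fun h a h1 h2 => ofAdd_eq_one.1 (h ⟨a, h1, h2⟩),
      fun h a => ofAdd_eq_one.2 (h a a.2.1 a.2.2)⟩
  let F : ∀ u : {u // D.Adj u c}, L →* Multiplicative (ZMod (π u)) := fun u =>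
    MonoidHom.mk' (fun g => Multiplicative.ofAdd (f u g)) fun g h =>
      congrArg Multiplicative.ofAdd (hf.map_mul u g h fun a ha =>
        (hmem g).1 g.2 a (by
          have := hD.lt_of_adj a u ha
          have := hnbr u u.2
          omega) (hD.not_adj_of_adj_adj a u c ha u.2))
  obtain ⟨χ, hχ1, hχ2⟩ := exists_character (fun u : {u // D.Adj u c} => hp u)
    (fun u v h => Subtype.ext (hD.injective h)) (r := π c)
    (fun u => hD.dvd_sub_one u c (hD.lt_of_adj u c u.2)) F
  have hfix : ∀ x : G, ¬ π c ∣ orderOf x →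
      (∀ u : {u // D.Adj u c}, Nat.Coprime (orderOf x) (π u)) →
      ∃ n : Multiplicative (coinducedModule χ), n ≠ 1 ∧ coinducedAction χ x n = n := by
    intro x hx hxu
    refine exists_coinducedAction_eq_self χ hx fun l hl => hχ1 l fun u =>
      (F u).eq_one_of_coprime_orderOf (n := π u) ?_ (pow_zmod_multiplicative _)
    rw [← Subgroup.orderOf_coe]
    exact (hxu u).coprime_dvd_left (orderOf_dvd_of_mem_zpowers hl)
  have : Finite (Multiplicative (coinducedModule χ)) := inferInstanceAs (Finite (coinducedModule χ))
  have : Nontrivial (Multiplicative (coinducedModule χ)) := by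
    obtain ⟨n, hn, -⟩ := hfix 1 (by rw [orderOf_one]; exact (hp c).not_dvd_one)
      fun u => by rw [orderOf_one]; exact Nat.coprime_one_left _
    exact ⟨n, 1, hn⟩
  have hN := isPGroup_coinducedModule χ
  refine ⟨Multiplicative (coinducedModule χ) ⋊[coinducedAction χ] G, inferInstance,
    fun v g => f v g.right, inferInstance, SemidirectProduct.isSolvable _, ?_, ?_⟩
  · refine hG.insert_sink hp hD.injective hc (hD.not_adj_self c) hsink hN _ ?_ ?_
    · intro v hv hvc x hx n hn
      have := Fact.mk (hp v)
      have hvs : v ∈ {v ∈ s | ℓ v ≤ 1} := ⟨hv, hnbr v hvc⟩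
      -- Elements of order `π v` have trivial images in the groups of orders `π a`, `a ≠ v`.
      have hxL : ∀ y : G, orderOf y = π v → y ∈ L := fun y hy => by
        rw [Subgroup.mem_iInf]
        intro a
        refine (E a).eq_one_of_coprime_orderOf (n := π a) ?_ (pow_zmod_multiplicative _)
        rw [hy]
        exact hD.coprime fun h => a.2.2 (h ▸ hvc)
      obtain ⟨g, hg, hg'⟩ := hf.exists_dual v hvs
      have hgL : g ∈ L := (hmem g).2 fun a _ ha => hg' a fun h => ha (h ▸ hvc)
      refine coinducedAction_fixedPointFree χ (hxL x hx) (fun h h1 => ?_) n hn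
      have hy : orderOf (h * x * h⁻¹) = π v := by
        rw [← MulAut.conj_apply, MulEquiv.orderOf_eq, hx]
      refine (F ⟨v, hvc⟩).ne_one_of_orderOf_eq (x := ⟨h * x * h⁻¹, hxL _ hy⟩)
        ⟨⟨g, hgL⟩, fun h => hg (ofAdd_eq_one.1 h)⟩
        (fun hd => hf.not_sq_dvd v hvs (hd.trans L.card_subgroup_dvd_card)) ?_
        (hχ2 ⟨v, hvc⟩ _ ?_ h1)
      · rwa [Subgroup.orderOf_mk]
      · rwa [Subgroup.orderOf_mk]
    · intro v hv hvc
      have := Fact.mk (hp v)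
      obtain ⟨x, hx⟩ := exists_prime_orderOf_dvd_card' (G := G) (π v)
        ((hG.dvd_card_iff _ (hp v)).2 ⟨v, hv, rfl⟩)
      refine ⟨x, hx, hfix x ?_ fun u => ?_⟩
      · rw [hx, Nat.prime_dvd_prime_iff_eq (hp c) (hp v)]
        exact fun h => hc (hD.injective h ▸ hv)
      · rw [hx]
        exact hD.coprime fun h => hvc (h ▸ u.2)
  · have hset : {v ∈ insert c s | ℓ v ≤ 1} = {v ∈ s | ℓ v ≤ 1} := by
      ext v
      refine ⟨fun h => ⟨h.1.resolve_left fun h' => ?_, h.2⟩, fun h => ⟨Or.inr h.1, h.2⟩⟩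
      have := h' ▸ h.2
      omega
    rw [hset]
    refine ⟨fun v hv g => hf.eq_zero v hv _, fun v g h hg => hf.map_mul v _ _ hg, fun v hv => ?_,
      fun v hv => ?_⟩
    · obtain ⟨g, hg⟩ := hf.exists_dual v hv
      exact ⟨SemidirectProduct.inr g, hg⟩
    · rw [SemidirectProduct.card]
      refine not_sq_dvd_mul (hp v) (fun h => ?_) (hf.not_sq_dvd v hv)
      obtain ⟨k, hk⟩ := IsPGroup.iff_card.1 hN
      rw [hk] at h
      exact hc (hD.injective ((Nat.prime_dvd_prime_iff_eq (hp v) (hp c)).1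
        ((hp v).dvd_of_dvd_pow h)) ▸ hv.1)

theorem exists_realizes [Finite V] (hD : IsLevelling D ℓ π) :
    ∃ (G : Type) (_ : Group G), Finite G ∧ Group.IsSolvable G ∧ Realizes D π Set.univ G := by
  classical
  have := Fintype.ofFinite V
  suffices H : ∀ s : Finset V, ∃ (G : Type) (_ : Group G) (f : ∀ v, G → ZMod (π v)), Finite G ∧
      Group.IsSolvable G ∧ Realizes D π s G ∧
        IsCoordinateSystem D π {v ∈ (s : Set V) | ℓ v ≤ 1} G f by
    obtain ⟨G, i, -, h1, h2, h3, -⟩ := H Finset.univ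
    rw [Finset.coe_univ] at h3
    exact ⟨G, i, h1, h2, h3⟩
  intro s
  -- Vertices are added by increasing level, so that each new vertex is a sink.
  induction s using Finset.induction_on_max_value ℓ with
  | empty =>
    refine ⟨Unit, inferInstance, fun _ _ => 0, inferInstance, inferInstance, ⟨?_, ?_, ?_⟩,
      ⟨?_, ?_, ?_, ?_⟩⟩
    · intro r hr
      simp [hr.ne_one]
    all_goals simp
  | insert c s hc hmax ih =>
    obtain ⟨G, i, f, h1, h2, h3, h4⟩ := ih
    rw [Finset.coe_insert]
    rcases Nat.lt_or_ge (ℓ c) 2 with hlt | hge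
    · exact hD.exists_insert_low hc hmax (Nat.lt_succ_iff.1 hlt) h3 h4
    · exact hD.exists_insert_high hc (le_antisymm (hD.le_two c) hge) h3 h4

end IsLevelling

/-! ### Levels and primes -/

/-- In an acyclic digraph without directed `3`-path, the sources get level `0`, the other vertices
all of whose in-neighbours are sources get level `1`, and the remaining vertices level `2`. -/
theorem Digraph.exists_level {V : Type*} {D : Digraph V} (hac : D.IsDirectedAcyclic)
    (hpath : ¬ D.HasDirectedPath 3) :
    ∃ ℓ : V → ℕ, (∀ v w, D.Adj v w → ℓ v < ℓ w) ∧ ∀ v, ℓ v ≤ 2 := by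
  classical
  let A : V → Prop := fun v => ∀ u, ¬ D.Adj u v
  let B : V → Prop := fun v => ∀ u, D.Adj u v → A u
  refine ⟨fun v => if A v then 0 else if B v then 1 else 2, fun v w hvw => ?_, fun v => by
    dsimp only; split_ifs <;> omega⟩
  have hw : ¬ A w := fun h => h v hvw
  by_cases hv : A v
  · simp only [if_pos hv, if_neg hw]
    split_ifs <;> omega
  · have hwB : ¬ B w := fun h => hv (h v hvw)
    have hvB : B v := by
      intro u huv
      by_contra hu
      obtain ⟨t, htu⟩ := not_forall_not.1 hu
      have htu' := Relation.TransGen.single htu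
      have huv' := Relation.TransGen.single huv
      have hvw' := Relation.TransGen.single hvw
      have hne : ∀ x y, Relation.TransGen D.Adj x y → x ≠ y := by
        rintro x _ h rfl
        exact hac x h
      have h1 := hne t u htu'
      have h2 := hne u v huv'
      have h3 := hne v w hvw'
      have h4 := hne t v (htu'.trans huv')
      have h5 := hne u w (huv'.trans hvw')
      have h6 := hne t w ((htu'.trans huv').trans hvw')
      refine hpath ⟨![t, u, v, w], fun i j hij => ?_, fun i => ?_⟩
      · clear hne
        fin_cases i <;> fin_cases j <;> simp_all
      · fin_cases i
        exacts [htu, huv, hvw]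
    simp only [if_neg hv, if_pos hvB, if_neg hw, if_neg hwB]
    omega

theorem exists_primes_of_level {V : Type*} [Finite V] (ℓ : V → ℕ) :
    ∃ π : V → ℕ, (∀ v, (π v).Prime) ∧ Function.Injective π ∧
      ∀ v w, ℓ v < ℓ w → π v ∣ π w - 1 := by
  obtain ⟨P, hP, hPlt⟩ := exists_seq_of_forall_finset_exists (α := ℕ) Nat.Prime
    (fun x y => x < y ∧ x ∣ y - 1) fun s hs => by
      obtain ⟨y, hy, hlt, hmod⟩ := Nat.exists_prime_gt_modEq_one (k := ∏ x ∈ s, x) (∑ x ∈ s, x)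
        (Finset.prod_ne_zero_iff.2 fun x hx => (hs x hx).ne_zero)
      refine ⟨y, hy, fun x hx => ⟨(Finset.single_le_sum (f := fun x => x)
        (fun _ _ => Nat.zero_le _) hx).trans_lt hlt, (Finset.dvd_prod_of_mem (fun x => x) hx).trans
          ((Nat.modEq_iff_dvd' hy.one_lt.le).1 hmod.symm)⟩⟩
  have hmono : StrictMono P := fun m n h => (hPlt m n h).1
  obtain ⟨n, ⟨e⟩⟩ := Finite.exists_equiv_fin V
  have hν : ∀ v w, ℓ v < ℓ w → ℓ v * n + e v < ℓ w * n + e w := fun v w h =>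
    calc ℓ v * n + e v < ℓ v * n + n := Nat.add_lt_add_left (e v).2 _
      _ = (ℓ v + 1) * n := by ring
      _ ≤ ℓ w * n := Nat.mul_le_mul_right n h
      _ ≤ ℓ w * n + e w := Nat.le_add_right _ _
  refine ⟨fun v => P (ℓ v * n + e v), fun v => hP _, fun v w h => ?_, fun v w h =>
    (hPlt _ _ (hν v w h)).2⟩
  have h' := hmono.injective h
  have hvw : ℓ v = ℓ w := by
    rcases lt_trichotomy (ℓ v) (ℓ w) with h1 | h1 | h1
    · exact absurd h' (hν v w h1).ne
    · exact h1
    · exact absurd h' (hν w v h1).ne'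
  rw [hvw] at h'
  exact e.injective (Fin.ext (Nat.add_left_cancel h'))

/-! ### The prime graph and the Frobenius digraph of a realization -/

theorem Realizes.exists_iso {V : Type*} {D : Digraph V} {F : SimpleGraph V}
    (hor : D.IsOrientationOf F) {π : V → ℕ} (hπ : ∀ v, (π v).Prime)
    (hinj : Function.Injective π) {G : Type*} [Group G] [Finite G]
    (hG : Realizes D π Set.univ G) :
    ∃ φ : F ≃g (primeGraph G)ᶜ, ∀ v w, D.Adj v w ↔ (frobeniusDigraph G).Adj (φ v) (φ w) := by
  have hdvd : ∀ v, π v ∣ Nat.card G := fun v => (hG.dvd_card_iff _ (hπ v)).2 ⟨v, trivial, rfl⟩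
  let e : V ≃ (Nat.card G).primeFactors := Equiv.ofBijective
    (fun v => ⟨π v, Nat.mem_primeFactors.2 ⟨hπ v, hdvd v, Nat.card_pos.ne'⟩⟩)
    ⟨fun v w h => hinj (congrArg Subtype.val h), fun r => by
      obtain ⟨h1, h2, -⟩ := Nat.mem_primeFactors.1 r.2
      obtain ⟨v, -, hv⟩ := (hG.dvd_card_iff _ h1).1 h2
      exact ⟨v, Subtype.ext hv⟩⟩
  have hadj : ∀ v w, (primeGraph G)ᶜ.Adj (e v) (e w) ↔ F.Adj v w := fun v w => by
    rw [SimpleGraph.compl_adj]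
    constructor
    · rintro ⟨hne, hn⟩
      by_contra hF
      rw [hor.1, not_or] at hF
      exact hn ⟨hne, hG.exists_orderOf v trivial w trivial (fun h => hne (h ▸ rfl)) hF.1 hF.2⟩
    · intro hF
      refine ⟨fun h => hF.ne (e.injective h), ?_⟩
      rintro ⟨-, g, hg⟩
      rcases (hor.1 v w).1 hF with h | h
      · exact (hG.isFrobeniusArc v trivial w trivial h).orderOf_ne g hg
      · exact (hG.isFrobeniusArc w trivial v trivial h).orderOf_ne g (hg.trans (mul_comm _ _))
  refine ⟨⟨e, fun {v w} => hadj v w⟩, fun v w => ?_⟩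
  have := Fact.mk (hπ v)
  have := Fact.mk (hπ w)
  constructor
  · intro h
    have hF : F.Adj v w := (hor.1 v w).2 (Or.inl h)
    have harc := hG.isFrobeniusArc v trivial w trivial h
    obtain ⟨H, hH⟩ := harc.exists_hall
    exact ⟨(hadj v w).2 hF, H, hH, Or.inl (harc.isFrobeniusWith (fun h => hF.ne (hinj h)) (hdvd v)
      (hdvd w) hH)⟩
  · rintro ⟨h, H, hH, hFr⟩
    refine ((hor.1 v w).1 ((hadj v w).1 h)).resolve_right fun hwv => ?_
    have harc := hG.isFrobeniusArc w trivial v trivial hwv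
    rcases hFr with ⟨P, Q, hPQ⟩ | h2
    · exact harc.not_isFrobeniusWith hH P Q hPQ
    · exact harc.not_isTwoFrobeniusOfType hH h2

theorem Digraph.exists_frobeniusDigraph_iso {V : Type*} [Finite V] {F : SimpleGraph V}
    (htri : F.CliqueFree 3) {D : Digraph V} (hor : D.IsOrientationOf F)
    (hac : D.IsDirectedAcyclic) (hpath : ¬ D.HasDirectedPath 3) :
    ∃ (G : Type) (_ : Group G), Finite G ∧ Group.IsSolvable G ∧
      ∃ φ : F ≃g (primeGraph G)ᶜ, ∀ v w, D.Adj v w ↔ (frobeniusDigraph G).Adj (φ v) (φ w) := by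
  classical
  obtain ⟨ℓ, h1, h2⟩ := D.exists_level hac hpath
  obtain ⟨π, h3, h4, h5⟩ := exists_primes_of_level ℓ
  have hD : IsLevelling D ℓ π := ⟨h1, h2, fun a b c hab hbc hac' =>
    htri {a, b, c} (SimpleGraph.is3Clique_triple_iff.2 ⟨(hor.1 a b).2 (Or.inl hab),
      (hor.1 a c).2 (Or.inl hac'), (hor.1 b c).2 (Or.inl hbc)⟩), h3, h4, h5⟩
  obtain ⟨G, i, hfin, hsol, hG⟩ := hD.exists_realizes
  exact ⟨G, i, hfin, hsol, hG.exists_iso hor h3 h4⟩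

/-- Directing every edge towards the larger colour of a `3`-colouring gives an acyclic orientation,
and a directed `3`-path would need four colours. -/
theorem SimpleGraph.Colorable.exists_orientation {V : Type*} {F : SimpleGraph V}
    (hcol : F.Colorable 3) :
    ∃ D : Digraph V, D.IsOrientationOf F ∧ D.IsDirectedAcyclic ∧ ¬ D.HasDirectedPath 3 := by
  obtain ⟨C⟩ := hcol
  refine ⟨⟨fun v w => F.Adj v w ∧ C v < C w⟩, ⟨fun v w => ?_, fun v w h => h.1.2.asymm h.2.2⟩,
    fun v h => ?_, ?_⟩
  · constructor
    · intro h
      exact (lt_or_gt_of_ne (C.valid h)).imp (fun h' => ⟨h, h'⟩) fun h' => ⟨h.symm, h'⟩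
    · rintro (h | h)
      exacts [h.1, h.1.symm]
  · have h' : Relation.TransGen (fun a b : Fin 3 => a < b) (C v) (C v) :=
      Relation.TransGen.lift (p := fun a b : Fin 3 => a < b) C (fun _ _ h => h.2) _ _ h
    rw [Relation.transGen_eq_self] at h'
    exact lt_irrefl _ h'
  · rintro ⟨f, -, hf⟩
    have h0 : C (f 0) < C (f 1) := (hf 0).2
    have h1 : C (f 1) < C (f 2) := (hf 1).2
    have h2 : C (f 2) < C (f 3) := (hf 2).2
    have := (C (f 3)).2
    rw [Fin.lt_def] at h0 h1 h2
    omega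

theorem mainTheorem2 {V : Type*} [Finite V] (F : SimpleGraph V)
    (hcol : F.Colorable 3) (htri : F.CliqueFree 3) :
    (∃ (G : Type) (_ : Group G), Finite G ∧ Group.IsSolvable G ∧ Nonempty (F ≃g (primeGraph G)ᶜ)) ∧
    (∃ D : Digraph V, D.IsOrientationOf F ∧ D.IsDirectedAcyclic ∧ ¬ D.HasDirectedPath 3) ∧
    (∀ D : Digraph V, D.IsOrientationOf F → D.IsDirectedAcyclic → ¬ D.HasDirectedPath 3 →
      ∃ (G : Type) (_ : Group G), Finite G ∧ Group.IsSolvable G ∧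
        ∃ φ : F ≃g (primeGraph G)ᶜ,
          ∀ v w, D.Adj v w ↔ (frobeniusDigraph G).Adj (φ v) (φ w)) := by
  refine ⟨?_, hcol.exists_orientation, fun D hor hac hpath =>
    Digraph.exists_frobeniusDigraph_iso htri hor hac hpath⟩
  obtain ⟨D, hor, hac, hpath⟩ := hcol.exists_orientation
  obtain ⟨G, i, hfin, hsol, φ, -⟩ := Digraph.exists_frobeniusDigraph_iso htri hor hac hpath
  exact ⟨G, i, hfin, hsol, ⟨φ⟩⟩
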